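/- For a real number $x$, let $S(\alpha)=\sum_{1\le n\le x}\tau(n)e(n\alpha)$, where $\tau(n)=\sum_{d\mid n}1$ is the divisor function and $e(t)=e^{2\pi i t}$. Then there are absolute constants $c,C>0$ such that, for every real $x\ge 2$, $$c\sqrt{x}\le\int_0^1|S(\alpha)|\,d\alpha\le C\sqrt{x}\,\log x.$$ -/

import Mathlib

/-- The exponential sum `S(α) = ∑_{1 ≤ n ≤ x} τ(n) e(nα)`, where `τ(n)` is the number of positive
divisors of `n` and `e(t) = exp(2πit)`, for a real number `x`. -/
noncomputable def divisorExpSum (x α : ℝ) : ℂ :=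
  ∑ n ∈ Finset.Icc 1 ⌊x⌋₊,
    (n.divisors.card : ℂ) * Complex.exp (2 * Real.pi * Complex.I * ((n : ℂ) * (α : ℂ)))

open Finset

/-! Lower bound. Put M = ⌊√⌊x⌋⌋ and test S against Fejér kernels of length M² centred at the reduced
fractions a/q with q ≤ M/K, K a constant. Integrating S against one such kernel gives a smoothed sum
of τ(n)cos(2πna/q). A smooth Dirichlet hyperbola decomposition bounds it below by (M²/q)(H_K − 97),
where H_K is the K-th harmonic number: multiples d = qj of q supply the harmonic sum, and the
remaining terms cost O(M²/q) (`smoothed_divisor_sum_at_fraction`). Fix K with H_K ≥ 98. Summed over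
the fractions, the tests total at least M²∑φ(q)/q, of order M²·M/K. The fractions are 1/M²-spaced
modulo 1, so their kernels add up to at most 16M² at every α (`sum_farey_fejer_le`). Since the
kernels are nonnegative, ∫|S| is at least a constant times M.

Signs are controlled throughout by one fact: a nonnegative convex sequence of finite support has a
nonnegative cosine series. The same summation by parts gives decay like 1/sin². The hyperbola cutoff
is a trapezoid because it is a combination of two convex ramps.

Upper bound. The sharp hyperbola method writes S as O(√x) geometric sums in dα, each of L¹ norm
O(log x) (`divisorExpSum_eq_hyperbola`, `integral_norm_geomExpSum_dilate_le`). -/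

/-! ### Cosine series with convex coefficients -/

/-- The cosine polynomial `a 0 + 2 ∑_{1 ≤ k ≤ X} a k cos (k θ)`. -/
noncomputable def cosSeries (a : ℕ → ℝ) (X : ℕ) (θ : ℝ) : ℝ :=
  a 0 + 2 * ∑ k ∈ range X, a (k + 1) * Real.cos ((k + 1 : ℕ) * θ)

/-- Summation by parts twice, with the boundary terms kept so that induction on the length applies.
-/
theorem two_sub_two_cos_mul_cosSeries (a : ℕ → ℝ) (θ : ℝ) (n : ℕ) :
    (2 - 2 * Real.cos θ) * cosSeries a n θ =
      2 * (a 0 - a 1)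
        - 2 * ∑ k ∈ range n, (a k - 2 * a (k + 1) + a (k + 2)) * Real.cos ((k + 1 : ℕ) * θ)
        + (2 * a (n + 1) * Real.cos (n * θ) - 2 * a n * Real.cos ((n + 1 : ℕ) * θ)) := by
  unfold cosSeries
  induction n with
  | zero => simp; ring
  | succ n ih =>
    rw [sum_range_succ, sum_range_succ]
    have h1 : Real.cos ((n + 1 + 1 : ℕ) * θ) + Real.cos (n * θ) =
        2 * Real.cos θ * Real.cos ((n + 1 : ℕ) * θ) := by
      have e1 : ((n + 1 + 1 : ℕ) : ℝ) * θ = (n + 1 : ℕ) * θ + θ := by push_cast; ring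
      have e2 : (n : ℝ) * θ = (n + 1 : ℕ) * θ - θ := by push_cast; ring
      rw [e1, e2, Real.cos_add, Real.cos_sub]; ring
    linear_combination ih + 2 * a (n + 1) * h1

theorem sum_range_second_difference (a : ℕ → ℝ) (n : ℕ) :
    ∑ k ∈ range n, (a k - 2 * a (k + 1) + a (k + 2)) = a 0 - a 1 - (a n - a (n + 1)) := by
  induction n with
  | zero => simp
  | succ n ih => rw [sum_range_succ, ih]; ring

theorem abs_sum_second_difference_mul_cos_le {a : ℕ → ℝ} {X : ℕ}
    (hconv : ∀ k, 0 ≤ a k - 2 * a (k + 1) + a (k + 2)) (hX : ∀ k, X ≤ k → a k = 0) (θ : ℝ) :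
    |∑ k ∈ range X, (a k - 2 * a (k + 1) + a (k + 2)) * Real.cos ((k + 1 : ℕ) * θ)| ≤
      a 0 - a 1 := by
  have h := sum_range_second_difference a X
  rw [hX X le_rfl, hX (X + 1) (by omega)] at h
  calc _ ≤ ∑ k ∈ range X, |(a k - 2 * a (k + 1) + a (k + 2)) * Real.cos ((k + 1 : ℕ) * θ)| :=
        abs_sum_le_sum_abs _ _
    _ ≤ ∑ k ∈ range X, (a k - 2 * a (k + 1) + a (k + 2)) := by
        refine sum_le_sum fun k _ => ?_
        rw [abs_mul, abs_of_nonneg (hconv k)]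
        exact mul_le_of_le_one_right (hconv k) (Real.abs_cos_le_one _)
    _ = _ := by rw [h]; ring

/-- After multiplication by 2 − 2cos θ the series is 2(a 0 − a 1) minus a cosine sum whose
coefficients are nonnegative and telescope to the same total. Where cos θ = 1 the factor vanishes,
but then every term is nonnegative. -/
theorem cosSeries_nonneg {a : ℕ → ℝ} {X : ℕ} (h0 : ∀ k, 0 ≤ a k)
    (hconv : ∀ k, 0 ≤ a k - 2 * a (k + 1) + a (k + 2)) (hX : ∀ k, X ≤ k → a k = 0) (θ : ℝ) :
    0 ≤ cosSeries a X θ := by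
  rcases (Real.cos_le_one θ).lt_or_eq with hlt | heq
  · have h := two_sub_two_cos_mul_cosSeries a θ X
    rw [hX X le_rfl, hX (X + 1) (by omega)] at h
    have hb := (abs_le.mp (abs_sum_second_difference_mul_cos_le hconv hX θ)).2
    have : 0 ≤ (2 - 2 * Real.cos θ) * cosSeries a X θ := by rw [h]; linarith
    exact nonneg_of_mul_nonneg_right this (by linarith)
  · obtain ⟨m, hm⟩ := (Real.cos_eq_one_iff θ).mp heq
    unfold cosSeries
    have : ∀ k ∈ range X, 0 ≤ a (k + 1) * Real.cos ((k + 1 : ℕ) * θ) := by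
      intro k _
      have : ((k + 1 : ℕ) : ℝ) * θ = (((k + 1 : ℕ) : ℤ) * m : ℤ) * (2 * Real.pi) := by
        rw [← hm]; push_cast; ring
      rw [this, Real.cos_int_mul_two_pi, mul_one]
      exact h0 _
    have := sum_nonneg this
    linarith [h0 0]

theorem cosSeries_mul_sin_sq_le {a : ℕ → ℝ} {X : ℕ}
    (hconv : ∀ k, 0 ≤ a k - 2 * a (k + 1) + a (k + 2)) (hX : ∀ k, X ≤ k → a k = 0) (t : ℝ) :
    cosSeries a X (2 * Real.pi * t) * Real.sin (Real.pi * t) ^ 2 ≤ a 0 - a 1 := by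
  have h := two_sub_two_cos_mul_cosSeries a (2 * Real.pi * t) X
  rw [hX X le_rfl, hX (X + 1) (by omega)] at h
  have hb := (abs_le.mp (abs_sum_second_difference_mul_cos_le hconv hX (2 * Real.pi * t))).1
  have hc : Real.cos (2 * Real.pi * t) = 1 - 2 * Real.sin (Real.pi * t) ^ 2 := by
    rw [show 2 * Real.pi * t = 2 * (Real.pi * t) by ring, Real.cos_two_mul, Real.cos_sq']; ring
  rw [hc] at h
  linarith

theorem cosSeries_le {a : ℕ → ℝ} {L : ℕ} (h0 : ∀ k, 0 ≤ a k) (h1 : ∀ k, a k ≤ 1)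
    (hL : ∀ k, L < k → a k = 0) (X : ℕ) (θ : ℝ) : cosSeries a X θ ≤ 1 + 2 * L := by
  have : ∑ k ∈ range X, a (k + 1) * Real.cos ((k + 1 : ℕ) * θ) ≤ L := by
    calc _ ≤ ∑ k ∈ range X, if k ∈ range L then (1 : ℝ) else 0 := by
          refine sum_le_sum fun k _ => ?_
          split_ifs with hk
          · exact (mul_le_of_le_one_right (h0 _) (Real.cos_le_one _)).trans (h1 _)
          · rw [hL _ (by simp at hk; omega), zero_mul]
      _ = #(range X ∩ range L) := by
          rw [← sum_filter, filter_mem_eq_inter]; simp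
      _ ≤ L := by
          exact_mod_cast (card_le_card inter_subset_right).trans (card_range L).le
  unfold cosSeries
  linarith [h1 0]

/-! ### Ramps and products of convex decreasing sequences -/

/-- The piecewise linear function `max 0 (1 - s k)`. -/
noncomputable def ramp (s : ℝ) (k : ℕ) : ℝ := max 0 (1 - s * k)

theorem ramp_nonneg (s : ℝ) (k : ℕ) : 0 ≤ ramp s k := le_max_left _ _

theorem ramp_zero_right (s : ℝ) : ramp s 0 = 1 := by simp [ramp]

theorem ramp_le_one {s : ℝ} (hs : 0 ≤ s) (k : ℕ) : ramp s k ≤ 1 := by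
  have : 0 ≤ s * k := by positivity
  exact max_le zero_le_one (by linarith)

theorem ramp_eq_zero {s : ℝ} {k : ℕ} (h : 1 ≤ s * k) : ramp s k = 0 :=
  max_eq_left (by linarith)

theorem le_ramp (s : ℝ) (k : ℕ) : 1 - s * k ≤ ramp s k := le_max_right _ _

theorem ramp_mul (s : ℝ) (d k : ℕ) : ramp s (d * k) = ramp (s * d) k := by
  simp [ramp, mul_assoc]

theorem ramp_succ_le {s : ℝ} (hs : 0 ≤ s) (k : ℕ) : ramp s (k + 1) ≤ ramp s k := by
  unfold ramp
  refine max_le_max le_rfl ?_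
  push_cast
  linarith

theorem ramp_second_difference_nonneg (s : ℝ) (k : ℕ) :
    0 ≤ ramp s k - 2 * ramp s (k + 1) + ramp s (k + 2) := by
  have h1 := le_ramp s k
  have h2 := le_ramp s (k + 2)
  have h3 := ramp_nonneg s k
  have h4 := ramp_nonneg s (k + 2)
  have h5 : ramp s (k + 1) = 0 ∨ ramp s (k + 1) = 1 - s * (k + 1 : ℕ) := max_choice _ _
  push_cast at *
  rcases h5 with h | h <;> rw [h] <;> linarith

theorem mul_second_difference_nonneg {a b : ℕ → ℝ} (ha : ∀ k, 0 ≤ a k) (hb : ∀ k, 0 ≤ b k)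
    (ha1 : ∀ k, a (k + 1) ≤ a k) (hb1 : ∀ k, b (k + 1) ≤ b k)
    (ha2 : ∀ k, 0 ≤ a k - 2 * a (k + 1) + a (k + 2))
    (hb2 : ∀ k, 0 ≤ b k - 2 * b (k + 1) + b (k + 2)) (k : ℕ) :
    0 ≤ a k * b k - 2 * (a (k + 1) * b (k + 1)) + a (k + 2) * b (k + 2) := by
  have e1 := mul_nonneg (ha (k + 1)) (hb2 k)
  have e2 := mul_nonneg (hb (k + 1)) (ha2 k)
  have e3 := mul_nonneg (sub_nonneg.2 (ha1 k)) (sub_nonneg.2 (hb1 k))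
  have e4 := mul_nonneg (sub_nonneg.2 (ha1 (k + 1))) (sub_nonneg.2 (hb1 (k + 1)))
  nlinarith

theorem inv_le_cosSeries_ramp {s : ℝ} (hs : 0 < s) {X : ℕ} (hX : 1 ≤ s * X) {θ : ℝ}
    (hθ : Real.cos θ = 1) : s⁻¹ ≤ cosSeries (ramp s) X θ := by
  obtain ⟨m, hm⟩ := (Real.cos_eq_one_iff θ).mp hθ
  have hcos : ∀ k : ℕ, Real.cos ((k + 1 : ℕ) * θ) = 1 := by
    intro k
    have : ((k + 1 : ℕ) : ℝ) * θ = (((k + 1 : ℕ) : ℤ) * m : ℤ) * (2 * Real.pi) := by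
      rw [← hm]; push_cast; ring
    rw [this, Real.cos_int_mul_two_pi]
  have hn1 : (⌊s⁻¹⌋₊ : ℝ) ≤ s⁻¹ := Nat.floor_le (by positivity)
  have hn2 : s⁻¹ < ⌊s⁻¹⌋₊ + 1 := Nat.lt_floor_add_one _
  have hnX : ⌊s⁻¹⌋₊ ≤ X := by
    refine Nat.floor_le_of_le ?_
    rw [inv_le_iff_one_le_mul₀' hs]; exact hX
  set n := ⌊s⁻¹⌋₊
  have hsum : ∀ j : ℕ, ∑ k ∈ range j, (1 - s * (k + 1 : ℕ)) = j - s * (j * (j + 1) / 2) := by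
    intro j
    induction j with
    | zero => simp
    | succ j ih => rw [sum_range_succ, ih]; push_cast; ring
  have hlow : (n : ℝ) - s * (n * (n + 1) / 2) ≤ ∑ k ∈ range X, ramp s (k + 1) := by
    rw [← hsum]
    calc _ ≤ ∑ k ∈ range n, ramp s (k + 1) := sum_le_sum fun k _ => le_ramp s (k + 1)
      _ ≤ _ := sum_le_sum_of_subset_of_nonneg (range_subset_range.2 hnX)
          fun k _ _ => ramp_nonneg _ _
  -- With y = 1/s, the difference of the two sides is exactly s(y − n)(n + 1 − y), nonnegative since
  -- n = ⌊y⌋.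
  have hkey : s⁻¹ ≤ 1 + 2 * (n - s * (n * (n + 1) / 2)) := by
    have hy : s * s⁻¹ = 1 := mul_inv_cancel₀ hs.ne'
    have h := mul_nonneg hs.le (mul_nonneg (sub_nonneg.2 hn1) (sub_nonneg.2 hn2.le))
    have : s * ((s⁻¹ - n) * (n + 1 - s⁻¹)) =
        (s * s⁻¹) * (2 * n + 1 - s⁻¹) - s * (n * (n + 1)) := by ring
    rw [this, hy] at h
    linarith
  unfold cosSeries
  simp only [hcos, mul_one, ramp_zero_right]
  linarith

/-! ### Sums over well-spaced points modulo 1 -/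

theorem sum_range_inv_succ_sq_le (n : ℕ) :
    ∑ j ∈ range n, 1 / ((j : ℝ) + 1) ^ 2 ≤ 2 := by
  suffices h : ∑ j ∈ range (n + 1), 1 / ((j : ℝ) + 1) ^ 2 ≤ 2 - 1 / ((n : ℝ) + 1) by
    have h1 : 0 ≤ 1 / ((n : ℝ) + 1) := by positivity
    have h2 : 0 ≤ 1 / ((n : ℝ) + 1) ^ 2 := by positivity
    rw [sum_range_succ] at h
    linarith
  induction n with
  | zero => norm_num
  | succ n ih =>
    rw [sum_range_succ]
    have : 1 / ((n : ℝ) + 1 + 1) ^ 2 ≤ 1 / ((n : ℝ) + 1) - 1 / ((n : ℝ) + 1 + 1) := by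
      rw [div_sub_div _ _ (by positivity) (by positivity), div_le_div_iff₀ (by positivity)
        (by positivity)]
      nlinarith
    push_cast
    linarith

theorem two_mul_min_le_sin {t : ℝ} (h0 : 0 ≤ t) (h1 : t ≤ 1) :
    2 * min t (1 - t) ≤ Real.sin (Real.pi * t) := by
  rcases le_total t (1 / 2) with h | h
  · rw [min_eq_left (by linarith)]
    have := Real.mul_le_sin (x := Real.pi * t) (by positivity) (by nlinarith [Real.pi_pos])
    have e : 2 / Real.pi * (Real.pi * t) = 2 * t := by field_simp
    linarith
  · rw [min_eq_right (by linarith)]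
    have := Real.mul_le_sin (x := Real.pi * (1 - t)) (mul_nonneg Real.pi_pos.le (by linarith))
      (by nlinarith [Real.pi_pos])
    have e : 2 / Real.pi * (Real.pi * (1 - t)) = 2 * (1 - t) := by field_simp
    rw [mul_sub, mul_one, Real.sin_pi_sub] at this
    rw [mul_sub, mul_one] at e
    linarith

theorem sin_sq_pi_mul_fract (t : ℝ) :
    Real.sin (Real.pi * Int.fract t) ^ 2 = Real.sin (Real.pi * t) ^ 2 := by
  have : Real.pi * Int.fract t = Real.pi * t - ⌊t⌋ * Real.pi := by
    rw [Int.fract]; ring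
  rw [this, Real.sin_sub_int_mul_pi, mul_pow, ← zpow_natCast ((-1 : ℝ) ^ ⌊t⌋), ← zpow_mul,
    mul_comm, mul_comm ⌊t⌋, zpow_mul]
  simp

/-- A point in the j-th of D equal cells is at least j/D from 0 or at least (D − 1 − j)/D from 1.
The bound A serves the extreme cells and B/sin² the others; adding both weights avoids recording
which end is nearer. -/
theorem le_of_mul_sin_sq_le {A B g t : ℝ} {D : ℕ} (hA : 0 ≤ A) (hB : 0 ≤ B)
    (ht0 : 0 ≤ t) (ht1 : t < 1) (hgA : g ≤ A) (hgB : g * Real.sin (Real.pi * t) ^ 2 ≤ B)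
    {j : ℕ} (hjD : j < D) (hj : j ≤ D * t) (hj' : D * t < j + 1) :
    g ≤ (A + B * D ^ 2) * (1 / ((j : ℝ) + 1) ^ 2 + 1 / (((D - 1 - j : ℕ) : ℝ) + 1) ^ 2) := by
  have hD : (0 : ℝ) < D := by exact_mod_cast (by omega : 0 < D)
  have hBD : 0 ≤ B * D ^ 2 := by positivity
  rcases le_or_gt g 0 with hg | hg
  · exact hg.trans (by positivity)
  obtain ⟨i, hi⟩ : ∃ i, D = j + 1 + i := ⟨D - (j + 1), by omega⟩
  have hi1 : D - 1 - j = i := by omega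
  rw [hi1]
  have hDr : (D : ℝ) = j + 1 + i := by rw [hi]; push_cast; ring
  have main : ∀ m : ℕ, (m : ℝ) ≤ D * min t (1 - t) → g ≤ (A + B * D ^ 2) * (1 / ((m : ℝ) + 1) ^ 2) := by
    intro m hm
    rw [mul_one_div, le_div_iff₀ (by positivity)]
    rcases Nat.eq_zero_or_pos m with rfl | hmp
    · simp; linarith
    · have hm1 : (1 : ℝ) ≤ m := by exact_mod_cast hmp
      have hs := two_mul_min_le_sin ht0 ht1.le
      -- Uses m + 1 ≤ 2m, which absorbs the factor 2 in the lower bound for the sine.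
      have h2 : (m : ℝ) + 1 ≤ D * Real.sin (Real.pi * t) := by nlinarith
      calc g * ((m : ℝ) + 1) ^ 2 ≤ g * (D * Real.sin (Real.pi * t)) ^ 2 := by gcongr
        _ = g * Real.sin (Real.pi * t) ^ 2 * D ^ 2 := by ring
        _ ≤ B * D ^ 2 := by gcongr
        _ ≤ _ := by linarith
  have hc : 0 ≤ A + B * D ^ 2 := by positivity
  rcases le_total t (1 - t) with h | h
  · refine (main j (by rw [min_eq_left h]; exact hj)).trans ?_
    gcongr
    simp; positivity
  · refine (main i (by rw [min_eq_right h]; nlinarith)).trans ?_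
    gcongr
    simp; positivity

/-- Each cell holds at most one point, so the sum is dominated by the cell weights; the two series
of inverse squares are at most 2 each, hence the 4. -/
theorem sum_le_of_well_spaced {ι : Type*} (s : Finset ι) (t g : ι → ℝ) {A B : ℝ} {D : ℕ}
    (hA : 0 ≤ A) (hB : 0 ≤ B) (hD : 0 < D)
    (hinj : ∀ i ∈ s, ∀ j ∈ s, ⌊D * Int.fract (t i)⌋₊ = ⌊D * Int.fract (t j)⌋₊ → i = j)
    (hgA : ∀ i ∈ s, g i ≤ A) (hgB : ∀ i ∈ s, g i * Real.sin (Real.pi * t i) ^ 2 ≤ B) :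
    ∑ i ∈ s, g i ≤ 4 * (A + B * D ^ 2) := by
  have hDr : (0 : ℝ) < D := by exact_mod_cast hD
  have hlt : ∀ i, ⌊D * Int.fract (t i)⌋₊ < D := by
    intro i
    rw [Nat.floor_lt (by have := Int.fract_nonneg (t i); positivity)]
    have := Int.fract_lt_one (t i)
    nlinarith
  have hc : 0 ≤ A + B * D ^ 2 := by positivity
  set W : ℕ → ℝ := fun j => 1 / ((j : ℝ) + 1) ^ 2 + 1 / (((D - 1 - j : ℕ) : ℝ) + 1) ^ 2
  have hW : ∑ j ∈ range D, W j ≤ 4 := by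
    simp only [W]
    rw [sum_add_distrib, sum_range_reflect (fun j : ℕ => 1 / ((j : ℝ) + 1) ^ 2) D]
    linarith [sum_range_inv_succ_sq_le D]
  calc ∑ i ∈ s, g i ≤ ∑ i ∈ s, (A + B * D ^ 2) * W ⌊D * Int.fract (t i)⌋₊ := by
        refine sum_le_sum fun i hi => ?_
        have h0 : 0 ≤ (D : ℝ) * Int.fract (t i) := mul_nonneg hDr.le (Int.fract_nonneg _)
        refine le_of_mul_sin_sq_le hA hB (Int.fract_nonneg (t i)) (Int.fract_lt_one _) (hgA i hi)
          ?_ (hlt i) (Nat.floor_le h0) (Nat.lt_floor_add_one _)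
        rw [sin_sq_pi_mul_fract]; exact hgB i hi
    _ = (A + B * D ^ 2) * ∑ j ∈ s.image fun i => ⌊D * Int.fract (t i)⌋₊, W j := by
        rw [← mul_sum, sum_image]
        intro i hi j hj h
        exact hinj i hi j hj h
    _ ≤ (A + B * D ^ 2) * ∑ j ∈ range D, W j := by
        gcongr
        · intro j hj
          obtain ⟨i, _, rfl⟩ := mem_image.1 hj
          exact mem_range.2 (hlt i)
    _ ≤ (A + B * D ^ 2) * 4 := by gcongr
    _ = _ := by ring

/-- Points of one cell have fractional parts less than 1/D apart; multiplied by the denominator e ≤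
D, this difference is an integer of absolute value below 1, hence zero. -/
theorem exists_int_sub_eq_of_floor_fract_eq {s t : ℝ} {D e : ℕ} {u : ℤ} (he : 0 < e)
    (heD : e ≤ D) (hu : (s - t) * e = u)
    (h : ⌊D * Int.fract s⌋₊ = ⌊D * Int.fract t⌋₊) : ∃ z : ℤ, s - t = z := by
  have hDr : (0 : ℝ) < D := by exact_mod_cast (by omega : 0 < D)
  have her : (0 : ℝ) < e := by exact_mod_cast he
  have hs0 : 0 ≤ D * Int.fract s := mul_nonneg hDr.le (Int.fract_nonneg _)
  have ht0 : 0 ≤ D * Int.fract t := mul_nonneg hDr.le (Int.fract_nonneg _)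
  have hs1 := Nat.floor_le hs0
  have hs2 := Nat.lt_floor_add_one (D * Int.fract s)
  have ht1 := Nat.floor_le ht0
  have ht2 := Nat.lt_floor_add_one (D * Int.fract t)
  rw [h] at hs1 hs2
  refine ⟨⌊s⌋ - ⌊t⌋, ?_⟩
  have hd : |D * (Int.fract s - Int.fract t)| < 1 := by rw [abs_lt]; constructor <;> linarith
  have hz : (e : ℝ) * (Int.fract s - Int.fract t) = ((u - e * (⌊s⌋ - ⌊t⌋) : ℤ) : ℝ) := by
    push_cast
    rw [Int.fract, Int.fract]
    linear_combination hu
  have habs : |((u - e * (⌊s⌋ - ⌊t⌋) : ℤ) : ℝ)| < 1 := by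
    rw [← hz]
    refine lt_of_le_of_lt ?_ hd
    rw [abs_mul, abs_mul, abs_of_pos hDr, abs_of_pos her]
    gcongr
  have hzero : u - e * (⌊s⌋ - ⌊t⌋) = 0 := by
    rw [← Int.cast_abs] at habs
    exact Int.abs_lt_one_iff.1 (by exact_mod_cast habs)
  rw [hzero, Int.cast_zero] at hz
  have := (mul_eq_zero.1 hz).resolve_left her.ne'
  rw [Int.fract, Int.fract] at this
  push_cast
  linarith

/-! ### Divisor sums, the hyperbola identity and the mean of φ(q)/q -/

theorem sum_range_succ_eq_sum_Icc {R : Type*} [AddCommMonoid R] (g : ℕ → R) (n : ℕ) :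
    ∑ k ∈ range n, g (k + 1) = ∑ k ∈ Icc 1 n, g k := by
  induction n with
  | zero => simp
  | succ n ih => rw [sum_range_succ, ih, sum_Icc_succ_top (by omega)]

theorem sum_card_divisors_mul {R : Type*} [CommRing R] (f : ℕ → R) (X : ℕ)
    (hf : ∀ n, X < n → f n = 0) :
    ∑ n ∈ Icc 1 X, (n.divisors.card : R) * f n = ∑ d ∈ Icc 1 X, ∑ k ∈ Icc 1 X, f (d * k) := by
  rw [← sum_product' (Icc 1 X) (Icc 1 X) fun d k => f (d * k)]
  have h1 : ∑ p ∈ Icc 1 X ×ˢ Icc 1 X, f (p.1 * p.2) =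
      ∑ p ∈ (Icc 1 X ×ˢ Icc 1 X).filter (fun p => p.1 * p.2 ∈ Icc 1 X), f (p.1 * p.2) := by
    rw [sum_filter]
    refine sum_congr rfl fun p hp => ?_
    split_ifs with h
    · rfl
    · apply hf
      simp only [mem_product, mem_Icc] at hp h
      have := Nat.mul_le_mul hp.1.1 hp.2.1
      omega
  rw [h1, ← sum_fiberwise_of_maps_to (t := Icc 1 X) (g := fun p : ℕ × ℕ => p.1 * p.2)
    (fun p hp => (mem_filter.1 hp).2)]
  refine sum_congr rfl fun n hn => ?_
  have h2 : ((Icc 1 X ×ˢ Icc 1 X).filter (fun p => p.1 * p.2 ∈ Icc 1 X)).filter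
      (fun p => p.1 * p.2 = n) = n.divisorsAntidiagonal := by
    ext ⟨d, k⟩
    simp only [mem_filter, mem_product, mem_Icc, Nat.mem_divisorsAntidiagonal] at hn ⊢
    constructor
    · rintro ⟨_, h⟩; exact ⟨h, by omega⟩
    · rintro ⟨h, h0⟩
      have hd : 0 < d := Nat.pos_of_ne_zero fun h => by simp_all
      have hk : 0 < k := Nat.pos_of_ne_zero fun h => by simp_all
      have := Nat.le_mul_of_pos_right d hk
      have := Nat.le_mul_of_pos_left k hd
      omega
  rw [h2, sum_congr rfl (g := fun _ => f n)
    (fun p hp => by rw [(Nat.mem_divisorsAntidiagonal.1 hp).1]), sum_const,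
    ← Nat.map_div_right_divisors, card_map, nsmul_eq_mul]

/-- Expand (1 − v d)(1 − v k) and use the symmetry of f(dk). Leaving the weight v free covers both
the trapezoid of the lower bound and the sharp cutoff of the upper bound. -/
theorem sum_sum_mul_eq_hyperbola {R : Type*} [CommRing R] (s : Finset ℕ) (f v : ℕ → R)
    (h : ∀ d ∈ s, ∀ k ∈ s, (1 - v d) * (1 - v k) * f (d * k) = 0) :
    ∑ d ∈ s, ∑ k ∈ s, f (d * k) =
      2 * ∑ d ∈ s, v d * ∑ k ∈ s, f (d * k) -
        ∑ d ∈ s, v d * ∑ k ∈ s, v k * f (d * k) := by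
  have h0 : ∑ d ∈ s, ∑ k ∈ s, (1 - v d) * (1 - v k) * f (d * k) = 0 :=
    sum_eq_zero fun d hd => sum_eq_zero fun k hk => h d hd k hk
  have h1 : ∑ d ∈ s, ∑ k ∈ s, v k * f (d * k) = ∑ d ∈ s, ∑ k ∈ s, v d * f (d * k) := by
    rw [sum_comm]
    exact sum_congr rfl fun d _ => sum_congr rfl fun k _ => by rw [mul_comm k d]
  have h2 : ∑ d ∈ s, ∑ k ∈ s, (1 - v d) * (1 - v k) * f (d * k) =
      ∑ d ∈ s, ∑ k ∈ s, f (d * k) - ∑ d ∈ s, ∑ k ∈ s, v d * f (d * k)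
       - ∑ d ∈ s, ∑ k ∈ s, v k * f (d * k) + ∑ d ∈ s, v d * ∑ k ∈ s, v k * f (d * k) := by
    simp only [mul_sum, ← sum_sub_distrib, ← sum_add_distrib]
    exact sum_congr rfl fun d _ => sum_congr rfl fun k _ => by ring
  rw [h0, h1] at h2
  simp only [mul_sum] at h2 ⊢
  simp only [← mul_sum] at h2 ⊢
  linear_combination -h2

/-- Sum m = ∑_{q ∣ m} φ(q) over m ≤ Q and exchange the order of summation. -/
theorem le_two_mul_sum_totient_div (Q : ℕ) :
    (Q : ℝ) ≤ 2 * ∑ q ∈ Icc 1 Q, (q.totient : ℝ) / q := by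
  rcases Nat.eq_zero_or_pos Q with rfl | hQ
  · simp
  have h1 : ∀ Q : ℕ, ∑ m ∈ Icc 1 Q, (m : ℝ) = Q * (Q + 1) / 2 := by
    intro Q
    induction Q with
    | zero => simp
    | succ n ih => rw [sum_Icc_succ_top (by omega), ih]; push_cast; ring
  have h2 : ∑ m ∈ Icc 1 Q, (m : ℝ) ≤ ∑ q ∈ Icc 1 Q, (q.totient : ℝ) * (Q / q) := by
    calc ∑ m ∈ Icc 1 Q, (m : ℝ)
        = ∑ m ∈ Icc 1 Q, ∑ q ∈ Icc 1 Q, if q ∣ m then (q.totient : ℝ) else 0 := by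
          refine sum_congr rfl fun m hm => ?_
          rw [← sum_filter]
          conv_lhs => rw [← Nat.sum_totient m]
          rw [Nat.cast_sum]
          refine sum_congr ?_ fun _ _ => rfl
          ext q
          simp only [mem_Icc, Nat.mem_divisors, mem_filter] at hm ⊢
          constructor
          · rintro ⟨h, h0⟩
            exact ⟨⟨Nat.pos_of_dvd_of_pos h hm.1, (Nat.le_of_dvd hm.1 h).trans hm.2⟩, h⟩
          · rintro ⟨_, h⟩; exact ⟨h, by omega⟩
      _ = ∑ q ∈ Icc 1 Q, (q.totient : ℝ) * (Q / q : ℕ) := by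
          rw [sum_comm]
          refine sum_congr rfl fun q _ => ?_
          rw [← sum_filter, sum_const, nsmul_eq_mul, mul_comm, ← Nat.Ioc_filter_dvd_card_eq_div]
          rfl
      _ ≤ _ := by
          refine sum_le_sum fun q _ => ?_
          gcongr
          exact Nat.cast_div_le
  have h3 : ∑ q ∈ Icc 1 Q, (q.totient : ℝ) * (Q / q) =
      Q * ∑ q ∈ Icc 1 Q, (q.totient : ℝ) / q := by
    rw [mul_sum]; exact sum_congr rfl fun q _ => by ring
  rw [h1, h3] at h2
  have hQ' : (0 : ℝ) < Q := by exact_mod_cast hQ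
  have : (Q : ℝ) * (Q / 2) ≤ Q * ∑ q ∈ Icc 1 Q, (q.totient : ℝ) / q := by nlinarith
  have := le_of_mul_le_mul_left this hQ'
  linarith

/-! ### The smoothed divisor sum at a rational point -/

/-- The trapezoid equal to `1` on `[0, M]` and to `0` beyond `2M`. -/
noncomputable def trapezoid (M k : ℕ) : ℝ := 2 * ramp (1 / (2 * M)) k - ramp (1 / M) k

theorem trapezoid_of_le {M k : ℕ} (hM : 0 < M) (h : k ≤ M) : trapezoid M k = 1 := by
  have hM' : (0 : ℝ) < M := by exact_mod_cast hM
  have h' : (k : ℝ) ≤ M := by exact_mod_cast h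
  have e : (k : ℝ) / M ≤ 1 := (div_le_one hM').2 h'
  have e0 : 0 ≤ (k : ℝ) / M := by positivity
  have e1 : 1 / (M : ℝ) * k = k / M := by ring
  have e2 : 1 / (2 * (M : ℝ)) * k = k / M / 2 := by field_simp
  rw [trapezoid, ramp, ramp, e1, e2, max_eq_right (by linarith), max_eq_right (by linarith)]
  ring

theorem trapezoid_of_two_mul_le {M k : ℕ} (hM : 0 < M) (h : 2 * M ≤ k) : trapezoid M k = 0 := by
  have hM' : (0 : ℝ) < M := by exact_mod_cast hM
  have h' : 2 * (M : ℝ) ≤ k := by exact_mod_cast h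
  have e : 2 ≤ (k : ℝ) / M := by rwa [le_div_iff₀ hM']
  have e1 : 1 / (M : ℝ) * k = k / M := by ring
  have e2 : 1 / (2 * (M : ℝ)) * k = k / M / 2 := by field_simp
  rw [trapezoid, ramp, ramp, e1, e2, max_eq_left (by linarith), max_eq_left (by linarith)]
  ring

theorem trapezoid_mem {M : ℕ} (hM : 0 < M) (k : ℕ) : 0 ≤ trapezoid M k ∧ trapezoid M k ≤ 1 := by
  have hM' : (0 : ℝ) < M := by exact_mod_cast hM
  have e1 : 1 / (M : ℝ) * k = k / M := by ring
  have e2 : 1 / (2 * (M : ℝ)) * k = k / M / 2 := by field_simp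
  have e0 : 0 ≤ (k : ℝ) / M := by positivity
  rw [trapezoid, ramp, ramp, e1, e2]
  rcases max_cases 0 (1 - (k : ℝ) / M / 2) with h | h <;>
    rcases max_cases 0 (1 - (k : ℝ) / M) with h' | h' <;> constructor <;> linarith

theorem sum_trapezoid_le {M : ℕ} (hM : 0 < M) (X : ℕ) :
    ∑ d ∈ Icc 1 X, trapezoid M d ≤ 2 * M := by
  calc _ ≤ ∑ d ∈ Icc 1 X, if d ∈ Icc 1 (2 * M) then (1 : ℝ) else 0 := by
        refine sum_le_sum fun d hd => ?_
        split_ifs with h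
        · exact (trapezoid_mem hM d).2
        · rw [trapezoid_of_two_mul_le hM]
          simp only [mem_Icc] at hd h; omega
    _ = #(Icc 1 X ∩ Icc 1 (2 * M)) := by
        rw [← sum_filter, filter_mem_eq_inter]; simp
    _ ≤ 2 * M := by
        have := card_le_card (inter_subset_right : Icc 1 X ∩ Icc 1 (2 * M) ⊆ _)
        rw [Nat.card_Icc, Nat.add_sub_cancel] at this
        exact_mod_cast this

theorem sum_Icc_mul_cos_eq (a : ℕ → ℝ) (X : ℕ) (θ : ℝ) :
    ∑ k ∈ Icc 1 X, a k * Real.cos (k * θ) = (cosSeries a X θ - a 0) / 2 := by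
  rw [cosSeries, ← sum_range_succ_eq_sum_Icc fun k : ℕ => a k * Real.cos (k * θ)]
  ring

/-- In the hyperbola identity the narrow ramp of the trapezoid enters with a favourable sign. Only
the wide ramp therefore has to be bounded from above later. -/
theorem smoothed_divisor_sum_lower_bound {M X : ℕ} (hM : 2 ≤ M) (hX : M ^ 2 ≤ X) (b : ℝ) :
    ∑ d ∈ Icc 1 X, trapezoid M d *
        cosSeries (ramp (1 / (M : ℝ) ^ 2 * d)) X (2 * Real.pi * (d * b)) - M -
      ∑ d ∈ Icc 1 X, trapezoid M d *
        cosSeries (fun k => ramp (1 / (2 * M)) k * ramp (1 / (M : ℝ) ^ 2 * d) k) X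
          (2 * Real.pi * (d * b)) ≤
    ∑ n ∈ Icc 1 X, (n.divisors.card : ℝ) *
      (ramp (1 / (M : ℝ) ^ 2) n * Real.cos (2 * Real.pi * (n * b))) := by
  have hM0 : 0 < M := by omega
  have hMr : (0 : ℝ) < M := by exact_mod_cast hM0
  have hzero : ∀ n : ℕ, M ^ 2 ≤ n → ramp (1 / (M : ℝ) ^ 2) n = 0 := by
    intro n hn
    apply ramp_eq_zero
    rw [div_mul_eq_mul_div, one_mul, le_div_iff₀ (by positivity), one_mul]
    exact_mod_cast hn
  set f : ℕ → ℝ := fun n => ramp (1 / (M : ℝ) ^ 2) n * Real.cos (2 * Real.pi * (n * b)) with hf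
  have hexp : ∀ d k : ℕ, f (d * k) =
      ramp (1 / (M : ℝ) ^ 2 * d) k * Real.cos (k * (2 * Real.pi * (d * b))) := by
    intro d k
    simp only [hf]
    rw [ramp_mul]
    congr 2
    push_cast; ring
  rw [sum_card_divisors_mul f X (fun n hn => by simp only [hf, hzero n (hX.trans hn.le), zero_mul]),
    sum_sum_mul_eq_hyperbola (Icc 1 X) f (trapezoid M)]
  · set P : ℕ → ℝ := fun d =>
      cosSeries (ramp (1 / (M : ℝ) ^ 2 * d)) X (2 * Real.pi * (d * b)) with hP
    set R : ℕ → ℝ := fun d => cosSeries (fun k => ramp (1 / (2 * M)) k *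
      ramp (1 / (M : ℝ) ^ 2 * d) k) X (2 * Real.pi * (d * b)) with hR
    set R' : ℕ → ℝ := fun d => cosSeries (fun k => ramp (1 / M) k *
      ramp (1 / (M : ℝ) ^ 2 * d) k) X (2 * Real.pi * (d * b)) with hR'
    have h1 : ∀ d, ∑ k ∈ Icc 1 X, f (d * k) = (P d - 1) / 2 := by
      intro d
      simp only [hexp]
      rw [sum_Icc_mul_cos_eq, ramp_zero_right]
    have h2 : ∀ d, ∑ k ∈ Icc 1 X, trapezoid M k * f (d * k) = R d - R' d / 2 - 1 / 2 := by
      intro d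
      have e1 := sum_Icc_mul_cos_eq (fun k => ramp (1 / (2 * M)) k *
        ramp (1 / (M : ℝ) ^ 2 * d) k) X (2 * Real.pi * (d * b))
      have e2 := sum_Icc_mul_cos_eq (fun k => ramp (1 / M) k *
        ramp (1 / (M : ℝ) ^ 2 * d) k) X (2 * Real.pi * (d * b))
      simp only [ramp_zero_right] at e1 e2
      have : ∀ k, trapezoid M k * f (d * k) =
          2 * (ramp (1 / (2 * M)) k * ramp (1 / (M : ℝ) ^ 2 * d) k *
            Real.cos (k * (2 * Real.pi * (d * b)))) -
          ramp (1 / M) k * ramp (1 / (M : ℝ) ^ 2 * d) k *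
            Real.cos (k * (2 * Real.pi * (d * b))) := by
        intro k; rw [hexp, trapezoid]; ring
      simp only [this, sum_sub_distrib, ← mul_sum]
      rw [e1, e2]
      simp only [hR, hR']
      ring
    have hR'0 : ∀ d ∈ Icc 1 X, 0 ≤ R' d := by
      intro d hd
      have hd1 := (mem_Icc.1 hd).1
      refine cosSeries_nonneg (fun k => mul_nonneg (ramp_nonneg _ _) (ramp_nonneg _ _))
        (mul_second_difference_nonneg (ramp_nonneg _) (ramp_nonneg _)
          (ramp_succ_le (by positivity)) (ramp_succ_le (by positivity))
          (ramp_second_difference_nonneg _) (ramp_second_difference_nonneg _)) ?_ _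
      intro k hk
      rw [← ramp_mul, hzero, mul_zero]
      nlinarith
    -- The nonnegative `R'` terms are dropped. The constants leave −½∑v(d), which is at least −M.
    have hS : ∑ d ∈ Icc 1 X, trapezoid M d * P d - ∑ d ∈ Icc 1 X, trapezoid M d * R d -
        (∑ d ∈ Icc 1 X, trapezoid M d) / 2 ≤ 2 * ∑ d ∈ Icc 1 X, trapezoid M d * ((P d - 1) / 2)
          - ∑ d ∈ Icc 1 X, trapezoid M d * (R d - R' d / 2 - 1 / 2) := by
      rw [mul_sum, ← sum_sub_distrib, ← sum_sub_distrib, sum_div, ← sum_sub_distrib]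
      refine sum_le_sum fun d hd => ?_
      have := mul_nonneg (trapezoid_mem hM0 d).1 (hR'0 d hd)
      linarith
    simp only [h1, h2]
    linarith [sum_trapezoid_le hM0 X]
  · intro d _ k _
    -- If both factors 1 − v are nonzero then d, k > M, so dk > M² and the ramp vanishes.
    rcases le_or_gt d M with h | h
    · rw [trapezoid_of_le hM0 h]; ring
    rcases le_or_gt k M with h' | h'
    · rw [trapezoid_of_le hM0 h']; ring
    simp only [hf]
    rw [hzero (d * k) (by nlinarith)]
    ring

theorem sum_range_mul_le {g : ℕ → ℝ} {q : ℕ} {c : ℝ}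
    (h : ∀ i, ∑ r ∈ range q, g (q * i + r) ≤ c) (b : ℕ) :
    ∑ d ∈ range (q * b), g d ≤ b * c := by
  induction b with
  | zero => simp
  | succ b ih =>
    rw [mul_add, mul_one, sum_range_add]
    push_cast
    linarith [h b]

/-- Over q consecutive integers d, the points da/q run once through the multiples of 1/q modulo 1.
-/
theorem floor_fract_fraction_injective {q a : ℕ} (hq : 0 < q) (ha : q.Coprime a) (i : ℕ) :
    ∀ r ∈ range q, ∀ r' ∈ range q,
      ⌊(q : ℝ) * Int.fract (((q * i + r : ℕ) : ℝ) * (a / q))⌋₊ =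
        ⌊(q : ℝ) * Int.fract (((q * i + r' : ℕ) : ℝ) * (a / q))⌋₊ → r = r' := by
  intro r hr r' hr' h
  have hqr : (q : ℝ) ≠ 0 := by exact_mod_cast hq.ne'
  obtain ⟨z, hz⟩ := exists_int_sub_eq_of_floor_fract_eq (e := q) (u := (r - r') * a) hq le_rfl
    (by push_cast; field_simp; ring) h
  have h1 : ((r : ℤ) - r') * a = z * q := by
    have : ((r : ℝ) - r') * a = z * q := by
      rw [← hz]; push_cast; field_simp; ring
    exact_mod_cast this
  have h2 : (q : ℤ) ∣ (r : ℤ) - r' := by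
    refine IsCoprime.dvd_of_dvd_mul_right (Nat.isCoprime_iff_coprime.2 ha) ?_
    exact ⟨z, by rw [h1]; ring⟩
  have h3 := Int.eq_zero_of_abs_lt_dvd h2 (by
    simp only [mem_range] at hr hr'
    rw [abs_lt]; constructor <;> omega)
  omega

/-- Cut the range d < 2M into at most 3M/q blocks of length q. On each block the well-spaced bound
with D = q, A = 5M and B = 3/M gives at most 32M. -/
theorem sum_trapezoid_mul_product_le {M X q a : ℕ} (hM : 2 ≤ M) (hX : M ^ 2 ≤ X) (hq : 0 < q)
    (hqM : q ≤ M) (ha : q.Coprime a) :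
    ∑ d ∈ Icc 1 X, trapezoid M d *
        cosSeries (fun k => ramp (1 / (2 * M)) k * ramp (1 / (M : ℝ) ^ 2 * d) k) X
          (2 * Real.pi * (d * (a / q))) ≤ 96 * ((M : ℝ) ^ 2 / q) := by
  have hM0 : 0 < M := by omega
  have hMr : (2 : ℝ) ≤ M := by exact_mod_cast hM
  have hqr : (0 : ℝ) < q := by exact_mod_cast hq
  have hqMr : (q : ℝ) ≤ M := by exact_mod_cast hqM
  have hvan : ∀ k, 2 * M ≤ k → ramp (1 / (2 * M)) k = 0 := by
    intro k hk
    apply ramp_eq_zero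
    rw [div_mul_eq_mul_div, one_mul, le_div_iff₀ (by positivity), one_mul]
    exact_mod_cast hk
  have h2MX : 2 * M ≤ X := by nlinarith
  set g : ℕ → ℝ := fun d => trapezoid M d *
        cosSeries (fun k => ramp (1 / (2 * M)) k * ramp (1 / (M : ℝ) ^ 2 * d) k) X
          (2 * Real.pi * (d * (a / q))) with hg
  have hconv : ∀ d : ℕ, ∀ k, 0 ≤ ramp (1 / (2 * M)) k * ramp (1 / (M : ℝ) ^ 2 * d) k -
      2 * (ramp (1 / (2 * M)) (k + 1) * ramp (1 / (M : ℝ) ^ 2 * d) (k + 1)) +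
      ramp (1 / (2 * M)) (k + 2) * ramp (1 / (M : ℝ) ^ 2 * d) (k + 2) := fun d =>
    mul_second_difference_nonneg (ramp_nonneg _) (ramp_nonneg _)
      (ramp_succ_le (by positivity)) (ramp_succ_le (by positivity))
      (ramp_second_difference_nonneg _) (ramp_second_difference_nonneg _)
  have hC0 : ∀ d : ℕ, 0 ≤ cosSeries (fun k => ramp (1 / (2 * M)) k *
      ramp (1 / (M : ℝ) ^ 2 * d) k) X (2 * Real.pi * (d * (a / q))) := fun d =>
    cosSeries_nonneg (fun k => mul_nonneg (ramp_nonneg _ _) (ramp_nonneg _ _)) (hconv d)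
      (fun k hk => by rw [hvan k (h2MX.trans hk), zero_mul]) _
  have hg0 : ∀ d, 0 ≤ g d := fun d => mul_nonneg (trapezoid_mem hM0 d).1 (hC0 d)
  have hgA : ∀ d, g d ≤ 5 * M := by
    intro d
    refine (mul_le_of_le_one_left (hC0 d) (trapezoid_mem hM0 d).2).trans ?_
    refine (cosSeries_le (L := 2 * M) (fun k => mul_nonneg (ramp_nonneg _ _) (ramp_nonneg _ _))
      (fun k => mul_le_one₀ (ramp_le_one (by positivity) _) (ramp_nonneg _ _)
        (ramp_le_one (by positivity) _))
      (fun k hk => by rw [hvan k hk.le, zero_mul]) _ _).trans ?_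
    push_cast
    linarith
  have hgB : ∀ d : ℕ, g d * Real.sin (Real.pi * (d * (a / q))) ^ 2 ≤ 3 / M := by
    intro d
    rcases le_or_gt (2 * M) d with h | h
    · simp only [hg]
      rw [trapezoid_of_two_mul_le hM0 h, zero_mul, zero_mul]
      positivity
    · have h1 := cosSeries_mul_sin_sq_le (hconv d)
        (fun k hk => by rw [hvan k (h2MX.trans hk), zero_mul]) (d * (a / q))
      have h2 : g d * Real.sin (Real.pi * (d * (a / q))) ^ 2 ≤ _ :=
        (mul_le_mul_of_nonneg_right (mul_le_of_le_one_left (hC0 d) (trapezoid_mem hM0 d).2)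
          (sq_nonneg _)).trans h1
      refine h2.trans ?_
      simp only [ramp_zero_right]
      have l1 := le_ramp (1 / (2 * M)) 1
      have l2 := le_ramp (1 / (M : ℝ) ^ 2 * d) 1
      have u1 := ramp_le_one (s := 1 / (2 * (M : ℝ))) (by positivity) 1
      have u2 := ramp_le_one (s := 1 / (M : ℝ) ^ 2 * d) (by positivity) 1
      -- Gives 1 − ab ≤ (1 − a) + (1 − b) for the two ramps at 1, so the bound is 1/(2M) + 2/M.
      have u3 := mul_nonneg (sub_nonneg.2 u1) (sub_nonneg.2 u2)
      have hd : 1 / (M : ℝ) ^ 2 * d ≤ 2 / M := by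
        have : (d : ℝ) ≤ 2 * M := by exact_mod_cast h.le
        calc 1 / (M : ℝ) ^ 2 * d ≤ 1 / (M : ℝ) ^ 2 * (2 * M) := by gcongr
          _ = _ := by field_simp
      have e1 : 1 / (2 * (M : ℝ)) = 1 / M / 2 := by field_simp
      have e2 : 2 / (M : ℝ) = 2 * (1 / M) := by ring
      have e3 : 3 / (M : ℝ) = 3 * (1 / M) := by ring
      have e4 : 0 ≤ 1 / (M : ℝ) := by positivity
      rw [Nat.cast_one, mul_one] at l1 l2
      linarith
  set c : ℝ := 4 * (5 * M + 3 / M * (q : ℝ) ^ 2)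
  have hblock : ∀ i, ∑ r ∈ range q, g (q * i + r) ≤ c := fun i =>
    sum_le_of_well_spaced (range q) (fun r => ((q * i + r : ℕ) : ℝ) * (a / q))
      (fun r => g (q * i + r)) (by positivity) (by positivity) hq
      (floor_fract_fraction_injective hq ha i) (fun r _ => hgA _) (fun r _ => hgB _)
  have hc : c ≤ 32 * M := by
    have : 3 / (M : ℝ) * (q : ℝ) ^ 2 ≤ 3 * M := by
      calc 3 / (M : ℝ) * (q : ℝ) ^ 2 ≤ 3 / (M : ℝ) * (M : ℝ) ^ 2 := by gcongr
        _ = _ := by field_simp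
    simp only [c]; linarith
  calc ∑ d ∈ Icc 1 X, g d ≤ ∑ d ∈ range (q * (2 * M / q + 1)), g d := by
        rw [← sum_filter_add_sum_filter_not (Icc 1 X) (· < 2 * M)]
        rw [sum_eq_zero (s := (Icc 1 X).filter (fun d => ¬ d < 2 * M)), add_zero]
        · refine sum_le_sum_of_subset_of_nonneg ?_ fun d _ _ => hg0 d
          intro d hd
          rw [mem_filter] at hd
          rw [mem_range]
          exact hd.2.trans (Nat.lt_mul_div_succ _ hq)
        · intro d hd
          simp only [hg]
          rw [trapezoid_of_two_mul_le hM0 (not_lt.1 (mem_filter.1 hd).2), zero_mul]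
    _ ≤ (2 * M / q + 1 : ℕ) * c := sum_range_mul_le hblock _
    _ ≤ (3 * M / q) * (32 * M) := by
        have : ((2 * M / q + 1 : ℕ) : ℝ) ≤ 3 * M / q := by
          push_cast
          have h1 : ((2 * M / q : ℕ) : ℝ) ≤ 2 * M / q := by
            refine Nat.cast_div_le.trans ?_
            push_cast; exact le_rfl
          have h2 : 1 ≤ (M : ℝ) / q := (one_le_div hqr).2 hqMr
          have h3 : 3 * (M : ℝ) / q = 2 * M / q + M / q := by ring
          linarith
        gcongr
    _ = _ := by ring

/-- All terms are nonnegative, so only d = qj with j ≤ K are kept. There the phase is trivial, the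
trapezoid is 1, and the Fejér kernel is at least M²/d. -/
theorem sum_inv_le_sum_trapezoid_mul_ramp {M X q a K : ℕ} (hM : 2 ≤ M) (hX : M ^ 2 ≤ X)
    (hq : 0 < q) (hKq : K * q ≤ M) :
    (M : ℝ) ^ 2 / q * ∑ j ∈ Icc 1 K, 1 / (j : ℝ) ≤ ∑ d ∈ Icc 1 X, trapezoid M d *
        cosSeries (ramp (1 / (M : ℝ) ^ 2 * d)) X (2 * Real.pi * (d * (a / q))) := by
  have hM0 : 0 < M := by omega
  have hMr : (2 : ℝ) ≤ M := by exact_mod_cast hM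
  have hqr : (0 : ℝ) < q := by exact_mod_cast hq
  have hMX : M ≤ X := by nlinarith
  have hXr : (M : ℝ) ^ 2 ≤ X := by exact_mod_cast hX
  have hslope : ∀ d k : ℕ, 1 ≤ d → X ≤ k → 1 ≤ 1 / (M : ℝ) ^ 2 * d * k := by
    intro d k hd hk
    have h1 : (1 : ℝ) ≤ d := by exact_mod_cast hd
    have h2 : (X : ℝ) ≤ k := by exact_mod_cast hk
    rw [mul_assoc, div_mul_eq_mul_div, one_mul, le_div_iff₀ (by positivity), one_mul]
    nlinarith [sq_nonneg (M : ℝ)]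
  set g : ℕ → ℝ := fun d => trapezoid M d *
        cosSeries (ramp (1 / (M : ℝ) ^ 2 * d)) X (2 * Real.pi * (d * (a / q))) with hg
  have hg0 : ∀ d ∈ Icc 1 X, 0 ≤ g d := fun d hd =>
    mul_nonneg (trapezoid_mem hM0 d).1 (cosSeries_nonneg (ramp_nonneg _)
      (ramp_second_difference_nonneg _)
      (fun k hk => ramp_eq_zero (hslope d k (mem_Icc.1 hd).1 hk)) _)
  have hle : ∀ j ∈ Icc 1 K, q * j ≤ M := by
    intro j hj
    have := (mem_Icc.1 hj).2
    nlinarith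
  calc (M : ℝ) ^ 2 / q * ∑ j ∈ Icc 1 K, 1 / (j : ℝ) ≤ ∑ j ∈ Icc 1 K, g (q * j) := by
        rw [mul_sum]
        refine sum_le_sum fun j hj => ?_
        have hj1 := (mem_Icc.1 hj).1
        have hjr : (1 : ℝ) ≤ j := by exact_mod_cast hj1
        have hqj : 1 ≤ q * j := Nat.mul_pos hq hj1
        have hs : 0 < 1 / (M : ℝ) ^ 2 * (q * j : ℕ) := by
          have : (0 : ℝ) < (q * j : ℕ) := by exact_mod_cast hqj
          positivity
        have h := inv_le_cosSeries_ramp hs (hslope _ X hqj le_rfl)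
          (θ := 2 * Real.pi * ((q * j : ℕ) * (a / q))) (by
            have : 2 * Real.pi * (((q * j : ℕ) : ℝ) * (a / q)) = (j * a : ℕ) * (2 * Real.pi) := by
              push_cast; field_simp
            rw [this, Real.cos_nat_mul_two_pi])
        simp only [hg]
        rw [trapezoid_of_le hM0 (hle j hj), one_mul]
        refine le_trans (le_of_eq ?_) h
        push_cast
        field_simp
    _ = ∑ d ∈ (Icc 1 K).image (q * ·), g d := by
        rw [sum_image]
        intro i _ j _ h
        exact Nat.eq_of_mul_eq_mul_left hq h
    _ ≤ _ := by
        refine sum_le_sum_of_subset_of_nonneg ?_ fun d hd _ => hg0 d hd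
        intro d hd
        obtain ⟨j, hj, rfl⟩ := mem_image.1 hd
        exact mem_Icc.2 ⟨Nat.mul_pos hq (mem_Icc.1 hj).1, (hle j hj).trans hMX⟩

theorem smoothed_divisor_sum_at_fraction {M X q a K : ℕ} (hM : 2 ≤ M) (hX : M ^ 2 ≤ X)
    (hq : 0 < q) (hqM : q ≤ M) (ha : q.Coprime a) (hKq : K * q ≤ M) :
    (M : ℝ) ^ 2 / q * (∑ j ∈ Icc 1 K, 1 / (j : ℝ) - 97) ≤
    ∑ n ∈ Icc 1 X, (n.divisors.card : ℝ) *
      (ramp (1 / (M : ℝ) ^ 2) n * Real.cos (2 * Real.pi * (n * (a / q)))) := by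
  have h1 := smoothed_divisor_sum_lower_bound hM hX (a / q)
  have h2 := sum_trapezoid_mul_product_le hM hX hq hqM ha
  have h3 := sum_inv_le_sum_trapezoid_mul_ramp (a := a) hM hX hq hKq
  have h4 : (M : ℝ) ≤ (M : ℝ) ^ 2 / q := by
    have hqr : (0 : ℝ) < q := by exact_mod_cast hq
    have hqMr : (q : ℝ) ≤ M := by exact_mod_cast hqM
    rw [le_div_iff₀ hqr]
    nlinarith
  linarith

/-! ### The lower bound: Fejér kernels at Farey fractions -/

theorem integral_exp_two_pi_int_mul (m : ℤ) :
    ∫ α in (0 : ℝ)..1, Complex.exp (2 * Real.pi * Complex.I * ((m : ℂ) * (α : ℂ))) =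
      if m = 0 then 1 else 0 := by
  split_ifs with h
  · simp [h]
  · have hc : 2 * Real.pi * Complex.I * (m : ℂ) ≠ 0 := by
      simp [Real.pi_ne_zero, h]
    simp only [← mul_assoc]
    rw [integral_exp_mul_complex hc]
    have : Complex.exp (2 * Real.pi * Complex.I * (m : ℂ) * (1 : ℝ)) = 1 := by
      rw [Complex.exp_eq_one_iff]
      exact ⟨m, by push_cast; ring⟩
    rw [this]
    simp

theorem integral_exp_mul_cos {n : ℕ} (hn : 1 ≤ n) (k : ℕ) (b : ℝ) :
    ∫ α in (0 : ℝ)..1, Complex.exp (2 * Real.pi * Complex.I * ((n : ℂ) * (α : ℂ))) *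
        (Real.cos (k * (2 * Real.pi * (b - α))) : ℂ) =
      if k = n then Complex.exp (2 * Real.pi * Complex.I * ((n : ℂ) * (b : ℂ))) / 2 else 0 := by
  have h : ∀ α : ℝ, Complex.exp (2 * Real.pi * Complex.I * ((n : ℂ) * (α : ℂ))) *
        (Real.cos (k * (2 * Real.pi * (b - α))) : ℂ) =
      Complex.exp (2 * Real.pi * Complex.I * (k * b)) / 2 *
        Complex.exp (2 * Real.pi * Complex.I * (((n - k : ℤ) : ℂ) * (α : ℂ))) +
      Complex.exp (-(2 * Real.pi * Complex.I * (k * b))) / 2 *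
        Complex.exp (2 * Real.pi * Complex.I * (((n + k : ℤ) : ℂ) * (α : ℂ))) := by
    intro α
    rw [Complex.ofReal_cos, Complex.cos, mul_div_assoc', mul_add, ← Complex.exp_add,
      ← Complex.exp_add, div_mul_eq_mul_div, div_mul_eq_mul_div, ← Complex.exp_add,
      ← Complex.exp_add, add_div]
    push_cast
    congr 3 <;> ring
  simp only [h]
  rw [intervalIntegral.integral_add (Continuous.intervalIntegrable (by fun_prop) _ _)
    (Continuous.intervalIntegrable (by fun_prop) _ _), intervalIntegral.integral_const_mul,
    intervalIntegral.integral_const_mul, integral_exp_two_pi_int_mul, integral_exp_two_pi_int_mul,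
    if_neg (by omega : ¬ ((n : ℤ) + k = 0))]
  rcases eq_or_ne k n with rfl | hk
  · simp
  · rw [if_neg (by omega), if_neg hk]; simp

theorem continuous_divisorExpSum (x : ℝ) : Continuous (divisorExpSum x) := by
  unfold divisorExpSum
  fun_prop

theorem continuous_cosSeries (a : ℕ → ℝ) (X : ℕ) : Continuous (cosSeries a X) := by
  unfold cosSeries
  fun_prop

theorem integral_divisorExpSum_mul_cosSeries (x : ℝ) (a : ℕ → ℝ) (b : ℝ) :
    (∫ α in (0 : ℝ)..1, divisorExpSum x α *
        (cosSeries a ⌊x⌋₊ (2 * Real.pi * (b - α)) : ℂ)).re =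
      ∑ n ∈ Icc 1 ⌊x⌋₊, (n.divisors.card : ℝ) * (a n * Real.cos (2 * Real.pi * (n * b))) := by
  set X := ⌊x⌋₊ with hX
  have h1 : ∀ α : ℝ, divisorExpSum x α * (cosSeries a X (2 * Real.pi * (b - α)) : ℂ) =
      ∑ n ∈ Icc 1 X, (n.divisors.card : ℂ) *
        (a 0 * (Complex.exp (2 * Real.pi * Complex.I * ((n : ℂ) * (α : ℂ))) *
          (Real.cos ((0 : ℕ) * (2 * Real.pi * (b - α))) : ℂ)) +
         2 * ∑ k ∈ Icc 1 X, a k * (Complex.exp (2 * Real.pi * Complex.I * ((n : ℂ) * (α : ℂ))) *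
          (Real.cos (k * (2 * Real.pi * (b - α))) : ℂ))) := by
    intro α
    rw [divisorExpSum, sum_mul]
    refine sum_congr rfl fun n _ => ?_
    rw [cosSeries, sum_range_succ_eq_sum_Icc
      fun k : ℕ => a k * Real.cos (k * (2 * Real.pi * (b - α)))]
    push_cast
    simp only [zero_mul, Complex.cos_zero, mul_one, mul_left_comm _ (Complex.exp _), ← mul_sum]
    ring
  have h2 : ∫ α in (0 : ℝ)..1, divisorExpSum x α *
      (cosSeries a X (2 * Real.pi * (b - α)) : ℂ) =
      ∑ n ∈ Icc 1 X, (n.divisors.card : ℂ) * (a n *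
        Complex.exp (2 * Real.pi * Complex.I * ((n : ℂ) * (b : ℂ)))) := by
    simp only [h1]
    rw [intervalIntegral.integral_finsetSum
      fun n _ => Continuous.intervalIntegrable (by fun_prop) _ _]
    refine sum_congr rfl fun n hn => ?_
    have hn1 := (mem_Icc.1 hn).1
    rw [intervalIntegral.integral_const_mul, intervalIntegral.integral_add
      (Continuous.intervalIntegrable (by fun_prop) _ _)
      (Continuous.intervalIntegrable (by fun_prop) _ _), intervalIntegral.integral_const_mul,
      intervalIntegral.integral_const_mul, intervalIntegral.integral_finsetSum
      fun k _ => Continuous.intervalIntegrable (by fun_prop) _ _]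
    simp only [intervalIntegral.integral_const_mul, integral_exp_mul_cos hn1]
    rw [if_neg (by omega)]
    simp only [mul_ite, mul_zero, sum_ite_eq', if_pos hn]
    ring
  rw [h2, Complex.re_sum]
  refine sum_congr rfl fun n _ => ?_
  have : Complex.exp (2 * Real.pi * Complex.I * ((n : ℂ) * (b : ℂ))) =
      Complex.exp ((2 * Real.pi * (n * b) : ℝ) * Complex.I) := by
    congr 1; push_cast; ring
  rw [this, ← Complex.ofReal_natCast, Complex.re_ofReal_mul, Complex.re_ofReal_mul,
    Complex.exp_ofReal_mul_I_re]

/-- A difference of two such fractions has denominator qq' ≤ M², so two of them in one cell agree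
modulo 1. Coprimality then forces equal denominators, and the range of a equal numerators. -/
theorem farey_floor_fract_injective {M Q : ℕ} (hQM : Q ≤ M) (α : ℝ) :
    ∀ p ∈ (Icc 1 Q).sigma fun q => (range q).filter q.Coprime,
    ∀ p' ∈ (Icc 1 Q).sigma fun q => (range q).filter q.Coprime,
      ⌊((M ^ 2 : ℕ) : ℝ) * Int.fract ((p.2 : ℝ) / p.1 - α)⌋₊ =
        ⌊((M ^ 2 : ℕ) : ℝ) * Int.fract ((p'.2 : ℝ) / p'.1 - α)⌋₊ → p = p' := by
  rintro ⟨q, a⟩ hp ⟨q', a'⟩ hp' h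
  simp only [mem_sigma, mem_Icc, mem_filter, mem_range] at hp hp' h
  obtain ⟨⟨hq1, hqQ⟩, haq, hco⟩ := hp
  obtain ⟨⟨hq1', hqQ'⟩, haq', hco'⟩ := hp'
  have hqr : (q : ℝ) ≠ 0 := by exact_mod_cast (by omega : q ≠ 0)
  have hqr' : (q' : ℝ) ≠ 0 := by exact_mod_cast (by omega : q' ≠ 0)
  obtain ⟨z, hz⟩ := exists_int_sub_eq_of_floor_fract_eq (e := q * q') (u := a * q' - a' * q)
    (Nat.mul_pos hq1 hq1') (by rw [sq]; exact Nat.mul_le_mul (by omega) (by omega))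
    (by push_cast; field_simp; ring) h
  have h1 : (a : ℤ) * q' - a' * q = z * (q * q') := by
    have : (a : ℝ) * q' - a' * q = z * (q * q') := by
      rw [← hz]; field_simp; ring
    exact_mod_cast this
  have hd1 : q ∣ q' := by
    have : (q : ℤ) ∣ q' := IsCoprime.dvd_of_dvd_mul_left (Nat.isCoprime_iff_coprime.2 hco)
      ⟨z * q' + a', by linarith⟩
    exact_mod_cast this
  have hd2 : q' ∣ q := by
    have : (q' : ℤ) ∣ q := IsCoprime.dvd_of_dvd_mul_left (Nat.isCoprime_iff_coprime.2 hco')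
      ⟨a - z * q, by linarith⟩
    exact_mod_cast this
  obtain rfl := Nat.dvd_antisymm hd1 hd2
  have h2 : (a : ℤ) - a' = z * q := by
    have hqz : (q : ℤ) ≠ 0 := by omega
    refine mul_right_cancel₀ hqz ?_
    linarith
  have h3 := Int.eq_zero_of_abs_lt_dvd (⟨z, by rw [h2]; ring⟩ : (q : ℤ) ∣ (a : ℤ) - a')
    (by rw [abs_lt]; constructor <;> omega)
  obtain rfl : a = a' := by omega
  rfl

theorem sum_farey_fejer_le {M X Q : ℕ} (hM : 0 < M) (hX : M ^ 2 ≤ X) (hQM : Q ≤ M) (α : ℝ) :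
    ∑ p ∈ (Icc 1 Q).sigma fun q => (range q).filter q.Coprime,
      cosSeries (ramp (1 / (M : ℝ) ^ 2)) X (2 * Real.pi * ((p.2 : ℝ) / p.1 - α)) ≤
        16 * (M : ℝ) ^ 2 := by
  have hM1 : (1 : ℝ) ≤ M := by exact_mod_cast hM
  have hzero : ∀ n : ℕ, M ^ 2 ≤ n → ramp (1 / (M : ℝ) ^ 2) n = 0 := by
    intro n hn
    apply ramp_eq_zero
    rw [div_mul_eq_mul_div, one_mul, le_div_iff₀ (by positivity), one_mul]
    exact_mod_cast hn
  have h := sum_le_of_well_spaced ((Icc 1 Q).sigma fun q => (range q).filter q.Coprime)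
    (fun p => (p.2 : ℝ) / p.1 - α)
    (fun p => cosSeries (ramp (1 / (M : ℝ) ^ 2)) X (2 * Real.pi * ((p.2 : ℝ) / p.1 - α)))
    (A := 3 * (M : ℝ) ^ 2) (B := 1 / (M : ℝ) ^ 2) (D := M ^ 2) (by positivity) (by positivity)
    (by positivity) (farey_floor_fract_injective hQM α) ?_ ?_
  · refine h.trans (le_of_eq ?_)
    push_cast
    field_simp
    ring
  · intro p _
    refine (cosSeries_le (L := M ^ 2) (ramp_nonneg _) (ramp_le_one (by positivity))
      (fun k hk => hzero k hk.le) _ _).trans ?_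
    push_cast
    nlinarith
  · intro p _
    refine (cosSeries_mul_sin_sq_le (ramp_second_difference_nonneg _)
      (fun k hk => hzero k (hX.trans hk)) _).trans ?_
    have := le_ramp (1 / (M : ℝ) ^ 2) 1
    rw [ramp_zero_right]
    push_cast at this
    linarith

/-- The Fourier coefficient of S at n = 1 is τ(1) = 1. This covers the bounded x for which M < K. -/
theorem one_le_integral_norm_divisorExpSum {x : ℝ} (hx : 1 ≤ x) :
    1 ≤ ∫ α in (0 : ℝ)..1, ‖divisorExpSum x α‖ := by
  have hX : 1 ∈ Icc 1 ⌊x⌋₊ := mem_Icc.2 ⟨le_rfl, Nat.le_floor (by simpa using hx)⟩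
  have h1 : ∫ α in (0 : ℝ)..1, divisorExpSum x α *
      Complex.exp (2 * Real.pi * Complex.I * (((-1 : ℤ) : ℂ) * (α : ℂ))) = 1 := by
    have h : ∀ α : ℝ, divisorExpSum x α *
        Complex.exp (2 * Real.pi * Complex.I * (((-1 : ℤ) : ℂ) * (α : ℂ))) =
        ∑ n ∈ Icc 1 ⌊x⌋₊, (n.divisors.card : ℂ) *
          Complex.exp (2 * Real.pi * Complex.I * (((n - 1 : ℤ) : ℂ) * (α : ℂ))) := by
      intro α
      rw [divisorExpSum, sum_mul]
      refine sum_congr rfl fun n _ => ?_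
      rw [mul_assoc, ← Complex.exp_add]
      congr 2
      push_cast; ring
    simp only [h]
    rw [intervalIntegral.integral_finsetSum
      fun n _ => Continuous.intervalIntegrable (by fun_prop) _ _]
    simp only [intervalIntegral.integral_const_mul, integral_exp_two_pi_int_mul]
    rw [sum_eq_single_of_mem 1 hX]
    · simp
    · intro n _ hn
      rw [if_neg (by omega), mul_zero]
  calc (1 : ℝ) = ‖∫ α in (0 : ℝ)..1, divisorExpSum x α *
      Complex.exp (2 * Real.pi * Complex.I * (((-1 : ℤ) : ℂ) * (α : ℂ)))‖ := by rw [h1]; simp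
    _ ≤ ∫ α in (0 : ℝ)..1, ‖divisorExpSum x α *
      Complex.exp (2 * Real.pi * Complex.I * (((-1 : ℤ) : ℂ) * (α : ℂ)))‖ :=
        intervalIntegral.norm_integral_le_integral_norm zero_le_one
    _ = _ := by
        refine intervalIntegral.integral_congr fun α _ => ?_
        simp only [norm_mul]
        have : 2 * Real.pi * Complex.I * (((-1 : ℤ) : ℂ) * (α : ℂ)) =
            (-(2 * Real.pi * α) : ℝ) * Complex.I := by push_cast; ring
        rw [this, Complex.norm_exp_ofReal_mul_I, mul_one]

theorem farey_lower_bound {x : ℝ} {M K : ℕ} (hM : 2 ≤ M) (hX : M ^ 2 ≤ ⌊x⌋₊)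
    (hH : 98 ≤ ∑ j ∈ Icc 1 K, 1 / (j : ℝ)) :
    ((M / K : ℕ) : ℝ) ≤ 32 * ∫ α in (0 : ℝ)..1, ‖divisorExpSum x α‖ := by
  set Q := M / K with hQ
  set X := ⌊x⌋₊ with hXdef
  have hM0 : 0 < M := by omega
  have hMr : (0 : ℝ) < M := by exact_mod_cast hM0
  have hQM : Q ≤ M := Nat.div_le_self _ _
  set s := (Icc 1 Q).sigma fun q => (range q).filter q.Coprime
  set F : ℝ → ℝ := cosSeries (ramp (1 / (M : ℝ) ^ 2)) X
  have hF0 : ∀ θ, 0 ≤ F θ := fun θ => cosSeries_nonneg (ramp_nonneg _)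
    (ramp_second_difference_nonneg _) (fun k hk => by
      apply ramp_eq_zero
      rw [div_mul_eq_mul_div, one_mul, le_div_iff₀ (by positivity), one_mul]
      exact_mod_cast hX.trans hk) _
  have hFc : Continuous F := continuous_cosSeries _ _
  have hSc := continuous_divisorExpSum x
  have h1 : ∀ p ∈ s, (M : ℝ) ^ 2 / p.1 ≤
      ∫ α in (0 : ℝ)..1, ‖divisorExpSum x α‖ * F (2 * Real.pi * ((p.2 : ℝ) / p.1 - α)) := by
    rintro ⟨q, a⟩ hp
    simp only [s, mem_sigma, mem_Icc, mem_filter, mem_range] at hp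
    obtain ⟨⟨hq1, hqQ⟩, haq, hco⟩ := hp
    have hKq : K * q ≤ M := (Nat.mul_le_mul_left K hqQ).trans (Nat.mul_div_le M K)
    have h := smoothed_divisor_sum_at_fraction hM hX hq1 (hqQ.trans hQM) hco hKq
    rw [← integral_divisorExpSum_mul_cosSeries] at h
    have h' : (M : ℝ) ^ 2 / q ≤ (M : ℝ) ^ 2 / q * (∑ j ∈ Icc 1 K, 1 / (j : ℝ) - 97) :=
      le_mul_of_one_le_right (by positivity) (by linarith)
    refine h'.trans (h.trans ((Complex.re_le_norm _).trans
      ((intervalIntegral.norm_integral_le_integral_norm zero_le_one).trans (le_of_eq ?_))))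
    refine intervalIntegral.integral_congr fun α _ => ?_
    simp only [norm_mul, Complex.norm_real]
    rw [Real.norm_of_nonneg (hF0 _)]
  have h2 : ∑ p ∈ s, (M : ℝ) ^ 2 / p.1 = (M : ℝ) ^ 2 * ∑ q ∈ Icc 1 Q, (q.totient : ℝ) / q := by
    rw [sum_sigma, mul_sum]
    refine sum_congr rfl fun q _ => ?_
    dsimp only
    rw [sum_const, nsmul_eq_mul, ← Nat.totient_eq_card_coprime]
    ring
  have h3 : ∑ p ∈ s, (M : ℝ) ^ 2 / p.1 ≤
      16 * (M : ℝ) ^ 2 * ∫ α in (0 : ℝ)..1, ‖divisorExpSum x α‖ := by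
    refine (sum_le_sum h1).trans ?_
    rw [← intervalIntegral.integral_finsetSum
      fun p _ => Continuous.intervalIntegrable (by fun_prop) _ _,
      ← intervalIntegral.integral_const_mul]
    refine intervalIntegral.integral_mono_on zero_le_one
      (Continuous.intervalIntegrable (by fun_prop) _ _)
      (Continuous.intervalIntegrable (by fun_prop) _ _) fun α _ => ?_
    rw [← mul_sum, mul_comm]
    gcongr
    exact sum_farey_fejer_le hM0 hX hQM α
  have h4 := le_two_mul_sum_totient_div Q
  rw [h2, mul_comm (16 : ℝ), mul_assoc] at h3
  have h5 := le_of_mul_le_mul_left h3 (by positivity)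
  linarith

theorem exists_mul_sqrt_le_integral_norm_divisorExpSum :
    ∃ c : ℝ, 0 < c ∧ ∀ x : ℝ, 1 ≤ x →
      c * Real.sqrt x ≤ ∫ α in (0 : ℝ)..1, ‖divisorExpSum x α‖ := by
  -- Divergence of the harmonic series; 98 = 97 + 1 leaves a main term of at least M²/q.
  obtain ⟨K, hK2, hH⟩ : ∃ K : ℕ, 2 ≤ K ∧ 98 ≤ ∑ j ∈ Icc 1 K, 1 / (j : ℝ) := by
    have h := Real.tendsto_sum_range_one_div_nat_succ_atTop
    obtain ⟨K, h1, h2⟩ := ((h.eventually_ge_atTop 98).and (Filter.eventually_ge_atTop 2)).exists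
    refine ⟨K, h2, ?_⟩
    rw [← sum_range_succ_eq_sum_Icc fun j : ℕ => 1 / (j : ℝ)]
    simpa using h1
  have hKr : (2 : ℝ) ≤ K := by exact_mod_cast hK2
  refine ⟨1 / (128 * K), by positivity, fun x hx => ?_⟩
  set M := Nat.sqrt ⌊x⌋₊ with hM
  have hX : M ^ 2 ≤ ⌊x⌋₊ := Nat.sqrt_le' _
  have hX1 : 1 ≤ ⌊x⌋₊ := Nat.le_floor (by simpa using hx)
  have hM1 : 1 ≤ M := Nat.sqrt_pos.2 hX1
  have hM1r : (1 : ℝ) ≤ M := by exact_mod_cast hM1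
  have hxM : Real.sqrt x ≤ 2 * M := by
    have h1 : x < (M + 1 : ℝ) ^ 2 := by
      have h2 : ⌊x⌋₊ + 1 ≤ (M + 1) ^ 2 := Nat.lt_succ_sqrt' _
      have h3 : ((⌊x⌋₊ : ℝ) + 1) ≤ (M + 1) ^ 2 := by exact_mod_cast h2
      linarith [Nat.lt_floor_add_one x]
    have := Real.sqrt_le_sqrt h1.le
    rw [Real.sqrt_sq (by positivity)] at this
    linarith
  rw [div_mul_eq_mul_div, one_mul, div_le_iff₀ (by positivity)]
  -- For M < K, √x ≤ 2K and ∫|S| ≥ 1 suffice. Otherwise √x ≤ 2M ≤ 4K⌊M/K⌋ ≤ 128K∫|S|.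
  rcases lt_or_ge M K with h | h
  · have h1 := one_le_integral_norm_divisorExpSum hx
    have : (M : ℝ) ≤ K := by exact_mod_cast h.le
    nlinarith
  · have h1 := farey_lower_bound (by omega) hX hH
    have h2 : (M : ℝ) ≤ 2 * K * (M / K : ℕ) := by
      have h3 : M < K * (M / K + 1) := Nat.lt_mul_div_succ _ (by omega)
      have h4 : 1 ≤ M / K := (Nat.one_le_div_iff (by omega)).2 h
      have : M ≤ 2 * K * (M / K) := by nlinarith
      exact_mod_cast this
    nlinarith

/-! ### The upper bound: L¹ norms of geometric sums -/

/-- The geometric sum `∑_{1 ≤ k ≤ L} e(k t)`. -/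
noncomputable def geomExpSum (L : ℕ) (t : ℝ) : ℂ :=
  ∑ k ∈ Icc 1 L, Complex.exp (2 * Real.pi * Complex.I * ((k : ℂ) * (t : ℂ)))

theorem continuous_geomExpSum (L : ℕ) : Continuous (geomExpSum L) := by
  unfold geomExpSum
  fun_prop

theorem norm_exp_two_pi_I_mul (k : ℕ) (t : ℝ) :
    ‖Complex.exp (2 * Real.pi * Complex.I * ((k : ℂ) * (t : ℂ)))‖ = 1 := by
  have : 2 * Real.pi * Complex.I * ((k : ℂ) * (t : ℂ)) =
      (2 * Real.pi * (k * t) : ℝ) * Complex.I := by push_cast; ring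
  rw [this, Complex.norm_exp_ofReal_mul_I]

theorem norm_geomExpSum_le (L : ℕ) (t : ℝ) : ‖geomExpSum L t‖ ≤ L := by
  refine (norm_sum_le _ _).trans ?_
  simp only [norm_exp_two_pi_I_mul]
  simp

theorem norm_geomExpSum_mul_sin_le (L : ℕ) (t : ℝ) :
    ‖geomExpSum L t‖ * |Real.sin (Real.pi * t)| ≤ 1 := by
  have h : ∀ L : ℕ, geomExpSum L t *
      (Complex.exp (2 * Real.pi * Complex.I * (((1 : ℕ) : ℂ) * (t : ℂ))) - 1) =
      Complex.exp (2 * Real.pi * Complex.I * (((L + 1 : ℕ) : ℂ) * (t : ℂ))) -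
        Complex.exp (2 * Real.pi * Complex.I * (((1 : ℕ) : ℂ) * (t : ℂ))) := by
    intro L
    induction L with
    | zero => simp [geomExpSum]
    | succ L ih =>
      have e : Complex.exp (2 * Real.pi * Complex.I * (((L + 1 + 1 : ℕ) : ℂ) * (t : ℂ))) =
          Complex.exp (2 * Real.pi * Complex.I * (((L + 1 : ℕ) : ℂ) * (t : ℂ))) *
          Complex.exp (2 * Real.pi * Complex.I * (((1 : ℕ) : ℂ) * (t : ℂ))) := by
        rw [← Complex.exp_add]; congr 1; push_cast; ring
      have e' : geomExpSum (L + 1) t = geomExpSum L t +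
          Complex.exp (2 * Real.pi * Complex.I * (((L + 1 : ℕ) : ℂ) * (t : ℂ))) :=
        sum_Icc_succ_top (by omega) _
      rw [e', add_mul, ih, e]
      ring
  have h1 : ‖geomExpSum L t‖ *
      ‖Complex.exp (2 * Real.pi * Complex.I * (((1 : ℕ) : ℂ) * (t : ℂ))) - 1‖ ≤ 2 := by
    rw [← norm_mul, h]
    refine (norm_sub_le _ _).trans ?_
    rw [norm_exp_two_pi_I_mul, norm_exp_two_pi_I_mul]
    norm_num
  have h2 : ‖Complex.exp (2 * Real.pi * Complex.I * (((1 : ℕ) : ℂ) * (t : ℂ))) - 1‖ =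
      2 * |Real.sin (Real.pi * t)| := by
    have e : 2 * Real.pi * Complex.I * (((1 : ℕ) : ℂ) * (t : ℂ)) =
        Complex.I * (2 * Real.pi * t : ℝ) := by push_cast; ring
    rw [e, Complex.norm_exp_I_mul_ofReal_sub_one, norm_mul, Real.norm_eq_abs, Real.norm_eq_abs,
      abs_two]
    congr 3
    ring
  rw [h2] at h1
  linarith

/-- Adding the bounds for the norm times 1/L and times the distance to the nearer endpoint gives 2.
Both endpoint terms are kept so that the majorant integrates to logarithms. -/
theorem norm_geomExpSum_le_add {L : ℕ} (hL : 0 < L) {t : ℝ} (h0 : 0 ≤ t) (h1 : t ≤ 1) :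
    ‖geomExpSum L t‖ ≤ 2 * (1 / (L : ℝ) + t)⁻¹ + 2 * (1 / (L : ℝ) + (1 - t))⁻¹ := by
  have hLr : (0 : ℝ) < L := by exact_mod_cast hL
  have hc : 0 < 1 / (L : ℝ) := by positivity
  have hn := norm_nonneg (geomExpSum L t)
  have e1 : ‖geomExpSum L t‖ * (1 / (L : ℝ)) ≤ 1 := by
    rw [mul_one_div, div_le_one hLr]; exact norm_geomExpSum_le L t
  have e2 : ‖geomExpSum L t‖ * min t (1 - t) ≤ 1 := by
    have hs := two_mul_min_le_sin h0 h1
    have hmin : 0 ≤ min t (1 - t) := le_min h0 (by linarith)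
    have := norm_geomExpSum_mul_sin_le L t
    rw [abs_of_nonneg (by linarith)] at this
    have := mul_le_mul_of_nonneg_left hs hn
    nlinarith
  have p1 : 0 < 1 / (L : ℝ) + t := by linarith
  have p2 : 0 < 1 / (L : ℝ) + (1 - t) := by linarith
  rcases le_total t (1 - t) with h | h
  · rw [min_eq_left h] at e2
    have : ‖geomExpSum L t‖ ≤ 2 * (1 / (L : ℝ) + t)⁻¹ := by
      rw [← div_eq_mul_inv, le_div_iff₀ p1]; linarith
    have : 0 < (1 / (L : ℝ) + (1 - t))⁻¹ := by positivity
    linarith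
  · rw [min_eq_right h] at e2
    have : ‖geomExpSum L t‖ ≤ 2 * (1 / (L : ℝ) + (1 - t))⁻¹ := by
      rw [← div_eq_mul_inv, le_div_iff₀ p2]; linarith
    have : 0 < (1 / (L : ℝ) + t)⁻¹ := by positivity
    linarith

theorem integral_norm_geomExpSum_le {L : ℕ} (hL : 0 < L) :
    ∫ t in (0 : ℝ)..1, ‖geomExpSum L t‖ ≤ 4 * Real.log (L + 1) := by
  have hLr : (0 : ℝ) < L := by exact_mod_cast hL
  have hc : 0 < 1 / (L : ℝ) := by positivity
  have i1 : IntervalIntegrable (fun t : ℝ => (1 / (L : ℝ) + t)⁻¹) MeasureTheory.volume 0 1 := by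
    refine ContinuousOn.intervalIntegrable_of_Icc zero_le_one ?_
    refine ContinuousOn.inv₀ (by fun_prop) fun t ht => ?_
    have := ht.1; positivity
  have i2 : IntervalIntegrable (fun t : ℝ => (1 / (L : ℝ) + (1 - t))⁻¹)
      MeasureTheory.volume 0 1 := by
    refine ContinuousOn.intervalIntegrable_of_Icc zero_le_one ?_
    refine ContinuousOn.inv₀ (by fun_prop) fun t ht => ?_
    have := sub_nonneg.2 ht.2; positivity
  have v1 : ∫ t in (0 : ℝ)..1, (1 / (L : ℝ) + t)⁻¹ = Real.log (L + 1) := by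
    rw [intervalIntegral.integral_comp_add_left (fun t => t⁻¹) (1 / (L : ℝ)),
      integral_inv_of_pos (by linarith) (by linarith)]
    congr 1
    field_simp
    ring
  have v2 : ∫ t in (0 : ℝ)..1, (1 / (L : ℝ) + (1 - t))⁻¹ = Real.log (L + 1) := by
    rw [intervalIntegral.integral_comp_sub_left (fun t => (1 / (L : ℝ) + t)⁻¹) 1]
    simpa using v1
  calc ∫ t in (0 : ℝ)..1, ‖geomExpSum L t‖
      ≤ ∫ t in (0 : ℝ)..1, (2 * (1 / (L : ℝ) + t)⁻¹ + 2 * (1 / (L : ℝ) + (1 - t))⁻¹) :=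
        intervalIntegral.integral_mono_on zero_le_one
          ((continuous_geomExpSum L).norm.intervalIntegrable _ _)
          ((i1.const_mul 2).add (i2.const_mul 2))
          fun t ht => norm_geomExpSum_le_add hL ht.1 ht.2
    _ = _ := by
        rw [intervalIntegral.integral_add (i1.const_mul 2) (i2.const_mul 2),
          intervalIntegral.integral_const_mul, intervalIntegral.integral_const_mul, v1, v2]
        ring

/-- The geometric sum has period 1, so dilating by the integer d preserves the mean over [0, 1]. -/
theorem integral_norm_geomExpSum_dilate_le {L d : ℕ} (hL : 0 < L) (hd : 0 < d) :
    ∫ t in (0 : ℝ)..1, ‖geomExpSum L (d * t)‖ ≤ 4 * Real.log (L + 1) := by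
  have hdr : (0 : ℝ) < d := by exact_mod_cast hd
  have hper : Function.Periodic (fun t => ‖geomExpSum L t‖) 1 := by
    intro t
    simp only [geomExpSum]
    congr 1
    refine sum_congr rfl fun k _ => ?_
    rw [Complex.exp_eq_exp_iff_exists_int]
    exact ⟨k, by push_cast; ring⟩
  have h := hper.intervalIntegral_add_zsmul_eq d 0
    (fun a b => (continuous_geomExpSum L).norm.intervalIntegrable a b)
  rw [intervalIntegral.integral_comp_mul_left (fun t => ‖geomExpSum L t‖) hdr.ne']
  simp only [zero_add, zsmul_eq_mul, Int.cast_natCast, mul_one] at h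
  rw [mul_zero, mul_one, h, smul_eq_mul, inv_mul_cancel_left₀ hdr.ne']
  exact integral_norm_geomExpSum_le hL

theorem divisorExpSum_eq_hyperbola (x α : ℝ) :
    divisorExpSum x α =
      2 * ∑ d ∈ Icc 1 (Nat.sqrt ⌊x⌋₊), geomExpSum (⌊x⌋₊ / d) (d * α) -
        ∑ d ∈ Icc 1 (Nat.sqrt ⌊x⌋₊), geomExpSum (Nat.sqrt ⌊x⌋₊) (d * α) := by
  set X := ⌊x⌋₊ with hX
  set M := Nat.sqrt X with hM
  have hMX : M ≤ X := Nat.sqrt_le_self X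
  have hMM : M * M ≤ X := Nat.sqrt_le X
  set f : ℕ → ℂ := fun n =>
    if n ≤ X then Complex.exp (2 * Real.pi * Complex.I * ((n : ℂ) * (α : ℂ))) else 0 with hf
  have h0 : divisorExpSum x α = ∑ n ∈ Icc 1 X, (n.divisors.card : ℂ) * f n := by
    refine sum_congr rfl fun n hn => ?_
    simp only [hf]
    rw [if_pos (mem_Icc.1 hn).2]
  have hsub : ∀ (g : ℕ → ℂ) (L : ℕ), L ≤ X →
      ∑ d ∈ Icc 1 X, (if d ≤ L then 1 else 0) * g d = ∑ d ∈ Icc 1 L, g d := by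
    intro g L hL
    simp only [ite_mul, one_mul, zero_mul]
    rw [← sum_filter]
    refine sum_congr ?_ fun _ _ => rfl
    ext d
    simp only [mem_filter, mem_Icc]
    omega
  have hexp : ∀ d k : ℕ, Complex.exp (2 * Real.pi * Complex.I * (((d * k : ℕ) : ℂ) * (α : ℂ))) =
      Complex.exp (2 * Real.pi * Complex.I * ((k : ℂ) * ((d * α : ℝ) : ℂ))) := by
    intro d k; congr 1; push_cast; ring
  rw [h0, sum_card_divisors_mul f X (fun n hn => if_neg (by omega)),
    sum_sum_mul_eq_hyperbola (Icc 1 X) f (fun d => if d ≤ M then 1 else 0), hsub _ _ hMX,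
    hsub _ _ hMX]
  · congr 1
    · congr 1
      refine sum_congr rfl fun d hd => ?_
      have hd1 := (mem_Icc.1 hd).1
      rw [geomExpSum, ← hsub _ _ (Nat.div_le_self X d)]
      refine sum_congr rfl fun k _ => ?_
      simp only [hf, hexp, ite_mul, one_mul, zero_mul]
      refine if_congr ?_ rfl rfl
      rw [Nat.le_div_iff_mul_le hd1, mul_comm]
    · refine sum_congr rfl fun d hd => ?_
      rw [hsub _ _ hMX]
      refine sum_congr rfl fun k hk => ?_
      have := Nat.mul_le_mul (mem_Icc.1 hd).2 (mem_Icc.1 hk).2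
      simp only [hf, hexp]
      rw [if_pos (by omega)]
  · intro d _ k _
    have hlt : X < (M + 1) * (M + 1) := Nat.lt_succ_sqrt X
    by_cases hd : d ≤ M
    · simp [hd]
    by_cases hk : k ≤ M
    · simp [hk]
    have := Nat.mul_le_mul (not_le.1 hd) (not_le.1 hk)
    simp only [hf]
    rw [if_neg (c := d * k ≤ X) (by simp only [Nat.succ_eq_add_one] at this; omega), mul_zero]

theorem integral_norm_divisorExpSum_le {x : ℝ} (hx : 2 ≤ x) :
    ∫ α in (0 : ℝ)..1, ‖divisorExpSum x α‖ ≤ 24 * (Real.sqrt x * Real.log x) := by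
  set X := ⌊x⌋₊ with hX
  set M := Nat.sqrt X with hM
  have hMX : M ≤ X := Nat.sqrt_le_self X
  have hXx : (X : ℝ) ≤ x := Nat.floor_le (by linarith)
  have hMr : (M : ℝ) ≤ Real.sqrt x := by
    refine Real.le_sqrt_of_sq_le (le_trans ?_ hXx)
    exact_mod_cast Nat.sqrt_le' X
  have hlogx : 0 ≤ Real.log x := Real.log_nonneg (by linarith)
  have hlog : ∀ L : ℕ, L ≤ X → 4 * Real.log (L + 1) ≤ 8 * Real.log x := by
    intro L hL
    have hLr : (L : ℝ) ≤ X := by exact_mod_cast hL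
    -- Here L + 1 ≤ x + 1 ≤ x², since x ≥ 2.
    have h1 : Real.log (L + 1) ≤ Real.log (x ^ 2) :=
      Real.log_le_log (by positivity) (by nlinarith)
    rw [Real.log_pow] at h1
    push_cast at h1
    linarith
  have hc : ∀ L d : ℕ, Continuous fun α : ℝ => ‖geomExpSum L (d * α)‖ := fun L d =>
    ((continuous_geomExpSum L).comp (by fun_prop)).norm
  have hI : ∀ (L : ℕ → ℕ), (∀ d ∈ Icc 1 M, 0 < L d ∧ L d ≤ X) →
      ∫ α in (0 : ℝ)..1, ∑ d ∈ Icc 1 M, ‖geomExpSum (L d) (d * α)‖ ≤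
        8 * (Real.sqrt x * Real.log x) := by
    intro L hL
    rw [intervalIntegral.integral_finsetSum fun d _ => (hc _ _).intervalIntegrable _ _]
    calc _ ≤ ∑ d ∈ Icc 1 M, 8 * Real.log x := sum_le_sum fun d hd =>
          (integral_norm_geomExpSum_dilate_le (hL d hd).1 (mem_Icc.1 hd).1).trans
            (hlog _ (hL d hd).2)
      _ = M * (8 * Real.log x) := by simp
      _ ≤ Real.sqrt x * (8 * Real.log x) := by gcongr
      _ = _ := by ring
  have hcs : ∀ L : ℕ → ℕ, Continuous fun α : ℝ =>
      ∑ d ∈ Icc 1 M, ‖geomExpSum (L d) (d * α)‖ := fun L =>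
    continuous_finsetSum _ fun d _ => hc _ _
  calc ∫ α in (0 : ℝ)..1, ‖divisorExpSum x α‖
      ≤ ∫ α in (0 : ℝ)..1, (2 * ∑ d ∈ Icc 1 M, ‖geomExpSum (X / d) (d * α)‖ +
          ∑ d ∈ Icc 1 M, ‖geomExpSum M (d * α)‖) := by
        refine intervalIntegral.integral_mono_on zero_le_one
          ((continuous_divisorExpSum x).norm.intervalIntegrable _ _)
          (((hcs fun d => X / d).const_mul 2).add (hcs fun _ => M) |>.intervalIntegrable _ _)
          fun α _ => ?_
        rw [divisorExpSum_eq_hyperbola]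
        refine (norm_sub_le _ _).trans ?_
        rw [norm_mul, Complex.norm_ofNat]
        gcongr <;> exact norm_sum_le _ _
    _ = 2 * (∫ α in (0 : ℝ)..1, ∑ d ∈ Icc 1 M, ‖geomExpSum (X / d) (d * α)‖) +
          ∫ α in (0 : ℝ)..1, ∑ d ∈ Icc 1 M, ‖geomExpSum M (d * α)‖ := by
        rw [intervalIntegral.integral_add
          (((hcs fun d => X / d).const_mul 2).intervalIntegrable _ _)
          ((hcs fun _ => M).intervalIntegrable _ _), intervalIntegral.integral_const_mul]
    _ ≤ 2 * (8 * (Real.sqrt x * Real.log x)) + 8 * (Real.sqrt x * Real.log x) := by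
        gcongr
        · refine hI (fun d => X / d) fun d hd => ⟨?_, Nat.div_le_self _ _⟩
          exact Nat.div_pos ((mem_Icc.1 hd).2.trans hMX) (mem_Icc.1 hd).1
        · refine hI (fun _ => M) fun d hd => ⟨?_, hMX⟩
          have := mem_Icc.1 hd
          omega
    _ = _ := by ring

theorem theorem1 :
    ∃ c C : ℝ, 0 < c ∧ 0 < C ∧ ∀ x : ℝ, 2 ≤ x →
      c * Real.sqrt x ≤ ∫ α in (0 : ℝ)..1, ‖divisorExpSum x α‖ ∧
      ∫ α in (0 : ℝ)..1, ‖divisorExpSum x α‖ ≤ C * (Real.sqrt x * Real.log x) := by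
  obtain ⟨c, hc, h⟩ := exists_mul_sqrt_le_integral_norm_divisorExpSum
  exact ⟨c, 24, hc, by norm_num, fun x hx =>
    ⟨h x (by linarith), integral_norm_divisorExpSum_le hx⟩⟩
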